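/- Let $\Omega\subset\mathbb{C}^2$ be a domain with $\mathcal C^\infty$-smooth boundary $b\Omega$ (not necessarily a bounded set) that is (Levi) pseudoconvex at every boundary point, and let $p_0\in b\Omega$. A smooth local defining function for $\Omega$ near $p_0$ on an open neighborhood $U$ of $p_0$ is a $\mathcal C^\infty$-smooth function $r:U\to\mathbb{R}$ with $\Omega\cap U=\{r<0\}$ and $dr\neq0$ on $b\Omega\cap U$. Write $H_r(V,W)=\sum_{j,k}\frac{\partial^2 r}{\partial z^j\partial\bar z^k}V^j\overline{W^k}$ for $(1,0)$-vectors $V=\sum_j V^j\frac{\partial}{\partial z^j}$ and $W=\sum_k W^k\frac{\partial}{\partial z^k}$; $r$ is plurisubharmonic on an open set $V\subset U$ if $H_r(\xi,\xi)\ge0$ at every point of $V$ for all $\xi\in\mathbb{C}^2$. With coordinates $(z,w)$ on $\mathbb{C}^2$, let near $b\Omega\cap U$ $$L=\frac{1}{\sqrt{|r_z|^2+|r_w|^2}}\Bigl(r_w\frac{\partial}{\partial z}-r_z\frac{\partial}{\partial w}\Bigr),\qquad N=\frac{1}{\sqrt{|r_z|^2+|r_w|^2}}\Bigl(r_{\bar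 z}\frac{\partial}{\partial z}+r_{\bar w}\frac{\partial}{\partial w}\Bigr),$$ and let $\nu=\operatorname{grad} r/|\operatorname{grad} r|$ be the real vector field with $N=\frac12(\nu+iT)$, $T$ real. For functions $f,g$, the notation $f=\mathcal{O}(g)$ on $b\Omega\cap U$ means that for every compact $K\subset b\Omega\cap U$ there is a constant $C>0$ such that $|f|\le C|g|$ on $K$. Then there exists a smooth local defining function for $\Omega$ near $p_0$ that is plurisubharmonic on some open neighborhood of $p_0$ if and only if there exist an open neighborhood $U$ of $p_0$ and a smooth local defining function $r$ for $\Omega$ near $p_0$ on $U$ such that $$|H_r(L,N)|^2=\mathcal{O}\bigl(H_r(L,L)\bigr)\ \text{ on } b\Omega\cap U\qquad\text{and}\qquad |\nu H_r(L,L)|^2=\mathcal{O}\bigl(H_r(L,L)\bigr)\ \text{ on } b\Omega\cap U.$$ -/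

import Mathlib

open scoped ContDiff Topology

noncomputable section

namespace PshBoundary

/-- The space `ℂ²` with its Euclidean norm; it is also used as the real space `ℝ⁴`. -/
abbrev C2 : Type := EuclideanSpace ℂ (Fin 2)

/-- `∂f/∂zʲ = (∂f/∂xʲ - i ∂f/∂yʲ) / 2`. -/
def dz (j : Fin 2) (f : C2 → ℂ) (q : C2) : ℂ :=
  (1 / 2 : ℂ) * (fderiv ℝ f q (EuclideanSpace.single j (1 : ℂ))
    - Complex.I * fderiv ℝ f q (EuclideanSpace.single j Complex.I))

/-- `∂f/∂z̄ʲ = (∂f/∂xʲ + i ∂f/∂yʲ) / 2`. -/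
def dzbar (j : Fin 2) (f : C2 → ℂ) (q : C2) : ℂ :=
  (1 / 2 : ℂ) * (fderiv ℝ f q (EuclideanSpace.single j (1 : ℂ))
    + Complex.I * fderiv ℝ f q (EuclideanSpace.single j Complex.I))

/-- A real function, regarded as a complex-valued one. -/
def toC (r : C2 → ℝ) (q : C2) : ℂ := (r q : ℂ)

/-- The pairing `⟨∂r, ξ⟩(q)`, where `ξ` stands for the `(1,0)` vector `∑ ξʲ ∂/∂zʲ` at `q`. -/
def delPairing (r : C2 → ℝ) (q ξ : C2) : ℂ := ∑ j, dz j (toC r) q * ξ j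

/-- The complex Hessian form `H_r(ξ, η)(q) = ∑ ∂²r/∂zʲ∂z̄ᵏ(q) ξʲ conj(ηᵏ)`. -/
def complexHessian (r : C2 → ℝ) (q ξ η : C2) : ℂ :=
  ∑ j, ∑ k, dz j (dzbar k (toC r)) q * ξ j * (starRingEnd ℂ) (η k)

/-- The quadratic form `H_r(ξ, ξ)(q)`. Its values are real wherever `r` is smooth, since
the complex Hessian of a real function is Hermitian. -/
def leviForm (r : C2 → ℝ) (q ξ : C2) : ℝ := (complexHessian r q ξ ξ).re

/-- `r` is plurisubharmonic on the (open) set `V`, for `r` of class `C²` on `V`. -/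
def PshOn (r : C2 → ℝ) (V : Set C2) : Prop := ∀ q ∈ V, ∀ ξ : C2, 0 ≤ leviForm r q ξ

/-- `r : U → ℝ` is a smooth local defining function for `Ω` near `p`.
Only the values of `r` on the open set `U` matter. -/
structure IsLocalDefiningFunction (Ω : Set C2) (p : C2) (U : Set C2) (r : C2 → ℝ) : Prop where
  isOpen : IsOpen U
  mem : p ∈ U
  smooth : ContDiffOn ℝ ∞ r U
  inter_eq : Ω ∩ U = {q | q ∈ U ∧ r q < 0}
  fderiv_ne_zero : ∀ q ∈ frontier Ω ∩ U, fderiv ℝ r q ≠ 0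

/-- `Ω` is a domain (open, connected, nonempty) with smooth boundary.
It need not be a bounded set. -/
structure IsSmoothlyBoundedDomain (Ω : Set C2) : Prop where
  isOpen : IsOpen Ω
  isConnected : IsConnected Ω
  exists_local : ∀ p ∈ frontier Ω, ∃ (U : Set C2) (r : C2 → ℝ), IsLocalDefiningFunction Ω p U r

/-- (Levi) pseudoconvexity at the boundary point `p`: near `p`, the form `H_r(ξ, ξ)` is
nonnegative on the `(1,0)` vectors `ξ` tangent to the boundary. -/
def PseudoconvexAt (Ω : Set C2) (p : C2) : Prop :=
  ∀ (U : Set C2) (r : C2 → ℝ), IsLocalDefiningFunction Ω p U r →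
    ∃ V : Set C2, IsOpen V ∧ p ∈ V ∧
      ∀ q ∈ frontier Ω ∩ (U ∩ V), ∀ ξ : C2, delPairing r q ξ = 0 → 0 ≤ leviForm r q ξ

/-- Pseudoconvexity of a smoothly bounded domain. -/
def Pseudoconvex (Ω : Set C2) : Prop := ∀ p ∈ frontier Ω, PseudoconvexAt Ω p

/-- The length of the form `∂r` at `q`; the forms `dz`, `dw` are orthogonal of length `√2`. -/
def normDel (r : C2 → ℝ) (q : C2) : ℝ :=
  Real.sqrt (2 * (‖dz 0 (toC r) q‖ ^ 2 + ‖dz 1 (toC r) q‖ ^ 2))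

/-- The vector field `L = (√2 / |∂r|) (r_w ∂/∂z - r_z ∂/∂w)`. -/
def vecL (r : C2 → ℝ) (q : C2) : C2 :=
  (Real.sqrt 2 / normDel r q) • !₂[dz 1 (toC r) q, -dz 0 (toC r) q]

/-- The vector field `N = (√2 / |∂r|) (r_z̄ ∂/∂z + r_w̄ ∂/∂w)`. -/
def vecN (r : C2 → ℝ) (q : C2) : C2 :=
  (Real.sqrt 2 / normDel r q) • !₂[dzbar 0 (toC r) q, dzbar 1 (toC r) q]

/-- The derivative `ν f`, where `ν` is the real vector field with `N = (ν + i T) / 2`, `T` real.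
Under `ℂ² = ℝ⁴` the real vector `ν` has the same complex coordinates as the `(1,0)` vector `N`;
it is `grad r / |grad r|`. -/
def nuDeriv (r : C2 → ℝ) (f : C2 → ℝ) (q : C2) : ℝ := fderiv ℝ f q (vecN r q)

/-- `f = O(g)` on `M`: a bound `|f| ≤ C |g|` on every compact subset of `M`. -/
def BigOOn (f g : C2 → ℝ) (M : Set C2) : Prop :=
  ∀ K : Set C2, IsCompact K → K ⊆ M → ∃ C : ℝ, 0 < C ∧ ∀ q ∈ K, |f q| ≤ C * |g q|

/-- The function `H_r(L, L)`, with `L` the vector field attached to `r`. -/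
def hessLL (r : C2 → ℝ) (q : C2) : ℝ := leviForm r q (vecL r q)

/-- The function `H_r(L, N)`, with `L` and `N` the vector fields attached to `r`. -/
def hessLN (r : C2 → ℝ) (q : C2) : ℂ := complexHessian r q (vecL r q) (vecN r q)

end PshBoundary

end

noncomputable section

namespace PshBoundary

/-! Write f = H_r(L,L). If r is plurisubharmonic near p₀, Cauchy–Schwarz for the semidefinite form
H_r gives |H_r(L,N)|² ≤ f · H_r(N,N) (`norm_complexHessian_sq_le`). Since f is nonnegative on a full
neighborhood and not only on the boundary, |df|² ≤ C f nearby (`exists_sq_fderiv_le`), in particular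
in the direction ν.

Conversely, a point q near p₀ lies on the normal line of a boundary point p, at distance O(|r(q)|)
(`exists_normal_projection`). In the Taylor expansion of f along this normal the linear term s·νf(p)
is absorbed by f(p)/2 and a multiple of s². Hence off the boundary μ = f + C r² is nonnegative and
|H_r(L,N)|² ≤ C μ (`exists_hessian_bounds`).

The plurisubharmonic function is r + φr² with φ = K + M|z - p₀|². In the frame L, N of the original
r, the term r²H_φ adds M r² to the LL entry, which beats the defect C r², and 2φ|∂r|² makes the NN
entry as large as desired. The LN entry sees K only through the factor 1 + 2rφ, which lies between
1/2 and 3/2 close to p₀. So M is fixed first, then K, then the neighborhood, and the 2×2 Hermitian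
matrix has nonnegative diagonal and determinant (`exists_leviForm_modify_nonneg`). -/

/-! ### Wirtinger derivatives and product rules for the complex Hessian -/

theorem contDiffAt_toC {r : C2 → ℝ} {q : C2} (hr : ContDiffAt ℝ ∞ r q) :
    ContDiffAt ℝ ∞ (toC r) q :=
  Complex.ofRealCLM.contDiff.contDiffAt.comp q hr

theorem contDiffAt_fderiv_apply {F : C2 → ℂ} {q : C2} (hF : ContDiffAt ℝ ∞ F q) (v : C2) :
    ContDiffAt ℝ ∞ (fun x => fderiv ℝ F x v) q :=
  (hF.fderiv_right (m := ∞) (by simp)).clm_apply contDiffAt_const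

theorem contDiffAt_dz {F : C2 → ℂ} {q : C2} (hF : ContDiffAt ℝ ∞ F q) (j : Fin 2) :
    ContDiffAt ℝ ∞ (dz j F) q :=
  contDiffAt_const.mul ((contDiffAt_fderiv_apply hF _).sub
    (contDiffAt_const.mul (contDiffAt_fderiv_apply hF _)))

theorem contDiffAt_dzbar {F : C2 → ℂ} {q : C2} (hF : ContDiffAt ℝ ∞ F q) (j : Fin 2) :
    ContDiffAt ℝ ∞ (dzbar j F) q :=
  contDiffAt_const.mul ((contDiffAt_fderiv_apply hF _).add
    (contDiffAt_const.mul (contDiffAt_fderiv_apply hF _)))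

theorem differentiableAt_of_smooth {E : Type*} [NormedAddCommGroup E] [NormedSpace ℝ E]
    {F : C2 → E} {q : C2} (hF : ContDiffAt ℝ ∞ F q) : DifferentiableAt ℝ F q :=
  hF.differentiableAt (by simp)

theorem eventually_smooth {E : Type*} [NormedAddCommGroup E] [NormedSpace ℝ E]
    {F : C2 → E} {q : C2} (hF : ContDiffAt ℝ ∞ F q) : ∀ᶠ x in 𝓝 q, DifferentiableAt ℝ F x := by
  -- Smoothness of order `∞` at a point need not persist nearby; finite order does.
  have h1 : ContDiffAt ℝ 1 F q := hF.of_le (by exact_mod_cast le_top)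
  filter_upwards [h1.eventually (by simp)] with x hx
  exact hx.differentiableAt (by simp)

theorem fderiv_toC {r : C2 → ℝ} {q : C2} (hr : DifferentiableAt ℝ r q) (v : C2) :
    fderiv ℝ (toC r) q v = (fderiv ℝ r q v : ℂ) := by
  have : HasFDerivAt (toC r) (Complex.ofRealCLM.comp (fderiv ℝ r q)) q :=
    Complex.ofRealCLM.hasFDerivAt.comp q hr.hasFDerivAt
  rw [this.fderiv]; rfl

theorem dzbar_toC {r : C2 → ℝ} {q : C2} (hr : DifferentiableAt ℝ r q) (j : Fin 2) :
    dzbar j (toC r) q = (starRingEnd ℂ) (dz j (toC r) q) := by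
  simp only [dzbar, dz, fderiv_toC hr]
  simp [Complex.conj_ofReal, Complex.conj_ofNat]

theorem dz_congr {F G : C2 → ℂ} {q : C2} (h : F =ᶠ[𝓝 q] G) (j : Fin 2) :
    dz j F q = dz j G q := by
  simp only [dz, h.fderiv_eq]

theorem dzbar_congr {F G : C2 → ℂ} {q : C2} (h : F =ᶠ[𝓝 q] G) (j : Fin 2) :
    dzbar j F q = dzbar j G q := by
  simp only [dzbar, h.fderiv_eq]

theorem dz_add {F G : C2 → ℂ} {q : C2} (hF : DifferentiableAt ℝ F q)
    (hG : DifferentiableAt ℝ G q) (j : Fin 2) :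
    dz j (fun x => F x + G x) q = dz j F q + dz j G q := by
  simp only [dz, fderiv_fun_add hF hG, add_apply]; ring

theorem dzbar_add {F G : C2 → ℂ} {q : C2} (hF : DifferentiableAt ℝ F q)
    (hG : DifferentiableAt ℝ G q) (j : Fin 2) :
    dzbar j (fun x => F x + G x) q = dzbar j F q + dzbar j G q := by
  simp only [dzbar, fderiv_fun_add hF hG, add_apply]; ring

theorem dz_mul {F G : C2 → ℂ} {q : C2} (hF : DifferentiableAt ℝ F q)
    (hG : DifferentiableAt ℝ G q) (j : Fin 2) :
    dz j (fun x => F x * G x) q = F q * dz j G q + G q * dz j F q := by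
  simp only [dz, fderiv_fun_mul hF hG, add_apply, smul_apply, smul_eq_mul]
  ring

theorem dzbar_mul {F G : C2 → ℂ} {q : C2} (hF : DifferentiableAt ℝ F q)
    (hG : DifferentiableAt ℝ G q) (j : Fin 2) :
    dzbar j (fun x => F x * G x) q = F q * dzbar j G q + G q * dzbar j F q := by
  simp only [dzbar, fderiv_fun_mul hF hG, add_apply, smul_apply, smul_eq_mul]
  ring

/-- For real r, dr is the sum of ∂r and its conjugate. -/
theorem fderiv_eq_delPairing {r : C2 → ℝ} {q : C2} (hr : DifferentiableAt ℝ r q) (v : C2) :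
    fderiv ℝ r q v = 2 * (delPairing r q v).re := by
  have hv : v = ∑ j, ((v j).re • EuclideanSpace.single j (1 : ℂ)
      + (v j).im • EuclideanSpace.single j Complex.I) := by
    ext i
    fin_cases i <;> simp [Fin.sum_univ_two]
  conv_lhs => rw [hv]
  simp only [map_add, map_smul, delPairing, dz, fderiv_toC hr, Fin.sum_univ_two]
  simp
  ring

theorem delPairing_mul {f g : C2 → ℝ} {q : C2} (hf : DifferentiableAt ℝ f q)
    (hg : DifferentiableAt ℝ g q) (ξ : C2) :
    delPairing (fun x => f x * g x) q ξ = f q * delPairing g q ξ + g q * delPairing f q ξ := by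
  have h : toC (fun x => f x * g x) = fun x => toC f x * toC g x := by
    ext x; simp [toC]
  have hf' : DifferentiableAt ℝ (toC f) q := Complex.ofRealCLM.differentiableAt.comp q hf
  have hg' : DifferentiableAt ℝ (toC g) q := Complex.ofRealCLM.differentiableAt.comp q hg
  simp only [delPairing, h, dz_mul hf' hg', Fin.sum_univ_two]
  simp only [toC.eq_def]
  ring

theorem complexHessian_add {f g : C2 → ℝ} {q : C2} (hf : ContDiffAt ℝ ∞ f q)
    (hg : ContDiffAt ℝ ∞ g q) (ξ η : C2) :
    complexHessian (fun x => f x + g x) q ξ η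
      = complexHessian f q ξ η + complexHessian g q ξ η := by
  have h : toC (fun x => f x + g x) = fun x => toC f x + toC g x := by
    ext x; simp [toC]
  have key : ∀ j k, dz j (dzbar k (toC fun x => f x + g x)) q
      = dz j (dzbar k (toC f)) q + dz j (dzbar k (toC g)) q := by
    intro j k
    rw [h, ← dz_add (differentiableAt_of_smooth (contDiffAt_dzbar (contDiffAt_toC hf) k))
      (differentiableAt_of_smooth (contDiffAt_dzbar (contDiffAt_toC hg) k))]
    apply dz_congr
    filter_upwards [eventually_smooth (contDiffAt_toC hf),
      eventually_smooth (contDiffAt_toC hg)] with x hx hx'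
    exact dzbar_add hx hx' k
  simp only [complexHessian, key, Fin.sum_univ_two]
  ring

theorem complexHessian_mul {f g : C2 → ℝ} {q : C2} (hf : ContDiffAt ℝ ∞ f q)
    (hg : ContDiffAt ℝ ∞ g q) (ξ η : C2) :
    complexHessian (fun x => f x * g x) q ξ η
      = f q * complexHessian g q ξ η + g q * complexHessian f q ξ η
        + delPairing f q ξ * (starRingEnd ℂ) (delPairing g q η)
        + delPairing g q ξ * (starRingEnd ℂ) (delPairing f q η) := by
  have h : toC (fun x => f x * g x) = fun x => toC f x * toC g x := by
    ext x; simp [toC]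
  have hf' := contDiffAt_toC hf
  have hg' := contDiffAt_toC hg
  have df := differentiableAt_of_smooth hf'
  have dg := differentiableAt_of_smooth hg'
  have key : ∀ j k, dz j (dzbar k (toC fun x => f x * g x)) q
      = toC f q * dz j (dzbar k (toC g)) q + toC g q * dz j (dzbar k (toC f)) q
        + dz j (toC f) q * dzbar k (toC g) q + dz j (toC g) q * dzbar k (toC f) q := by
    intro j k
    have bf := differentiableAt_of_smooth (contDiffAt_dzbar hf' k)
    have bg := differentiableAt_of_smooth (contDiffAt_dzbar hg' k)
    have : dzbar k (fun x => toC f x * toC g x) =ᶠ[𝓝 q]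
        fun x => toC f x * dzbar k (toC g) x + toC g x * dzbar k (toC f) x := by
      filter_upwards [eventually_smooth hf', eventually_smooth hg'] with x hx hx'
      exact dzbar_mul hx hx' k
    rw [h, dz_congr this, dz_add (df.fun_mul bg) (dg.fun_mul bf), dz_mul df bg, dz_mul dg bf]
    ring
  simp only [complexHessian, key, Fin.sum_univ_two, delPairing, toC,
    dzbar_toC (differentiableAt_of_smooth hf), dzbar_toC (differentiableAt_of_smooth hg),
    map_add, map_mul]
  simp only [← toC.eq_def]
  ring

theorem fderiv_fderiv_apply {F : C2 → ℂ} {q : C2} (hF : ContDiffAt ℝ ∞ F q) (v w : C2) :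
    fderiv ℝ (fun x => fderiv ℝ F x v) q w = fderiv ℝ (fderiv ℝ F) q w v := by
  have h : DifferentiableAt ℝ (fderiv ℝ F) q :=
    differentiableAt_of_smooth (hF.fderiv_right (m := ∞) (by simp))
  rw [fderiv_clm_apply h (differentiableAt_const v)]
  simp

/-- Symmetry of the second real derivative; this is what makes the complex Hessian of a real
function Hermitian. -/
theorem dz_dzbar_eq {F : C2 → ℂ} {q : C2} (hF : ContDiffAt ℝ ∞ F q) (j k : Fin 2) :
    dz j (dzbar k F) q = dzbar k (dz j F) q := by
  have hs : ∀ v w, fderiv ℝ (fderiv ℝ F) q v w = fderiv ℝ (fderiv ℝ F) q w v :=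
    hF.isSymmSndFDerivAt (by simpa using
      (WithTop.coe_le_coe.2 le_top : ((2 : ℕ∞) : WithTop ℕ∞) ≤ ∞))
  have d : ∀ v, DifferentiableAt ℝ (fun x => fderiv ℝ F x v) q := fun v =>
    differentiableAt_of_smooth (contDiffAt_fderiv_apply hF v)
  have e1 : ∀ v, fderiv ℝ (dzbar k F) q v = (1 / 2 : ℂ) *
      (fderiv ℝ (fderiv ℝ F) q v (EuclideanSpace.single k 1)
        + Complex.I * fderiv ℝ (fderiv ℝ F) q v (EuclideanSpace.single k Complex.I)) := by
    intro v
    unfold dzbar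
    rw [fderiv_const_mul ((d _).fun_add ((d _).const_mul _)),
      fderiv_fun_add (d _) ((d _).const_mul _), fderiv_const_mul (d _)]
    simp only [smul_apply, add_apply, smul_eq_mul, fderiv_fderiv_apply hF]
  have e2 : ∀ v, fderiv ℝ (dz j F) q v = (1 / 2 : ℂ) *
      (fderiv ℝ (fderiv ℝ F) q v (EuclideanSpace.single j 1)
        - Complex.I * fderiv ℝ (fderiv ℝ F) q v (EuclideanSpace.single j Complex.I)) := by
    intro v
    unfold dz
    rw [fderiv_const_mul ((d _).fun_sub ((d _).const_mul _)),
      fderiv_fun_sub (d _) ((d _).const_mul _), fderiv_const_mul (d _)]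
    simp only [smul_apply, sub_apply, smul_eq_mul, fderiv_fderiv_apply hF]
  rw [dz, dzbar]
  simp only [e1, e2]
  rw [hs (EuclideanSpace.single k 1) (EuclideanSpace.single j 1),
    hs (EuclideanSpace.single k 1) (EuclideanSpace.single j Complex.I),
    hs (EuclideanSpace.single k Complex.I) (EuclideanSpace.single j 1),
    hs (EuclideanSpace.single k Complex.I) (EuclideanSpace.single j Complex.I)]
  ring

theorem dzbar_conj {F : C2 → ℂ} {q : C2} (hF : DifferentiableAt ℝ F q) (j : Fin 2) :
    dzbar j (fun x => (starRingEnd ℂ) (F x)) q = (starRingEnd ℂ) (dz j F q) := by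
  have : HasFDerivAt (fun x => (starRingEnd ℂ) (F x))
      ((Complex.conjCLE : ℂ →L[ℝ] ℂ).comp (fderiv ℝ F q)) q :=
    (Complex.conjCLE : ℂ →L[ℝ] ℂ).hasFDerivAt.comp q hF.hasFDerivAt
  simp only [dzbar, dz, this.fderiv]
  simp [Complex.conj_ofNat]

theorem conj_complexHessian {r : C2 → ℝ} {q : C2} (hr : ContDiffAt ℝ ∞ r q) (ξ η : C2) :
    (starRingEnd ℂ) (complexHessian r q ξ η) = complexHessian r q η ξ := by
  have hr' := contDiffAt_toC hr
  have key : ∀ j k, (starRingEnd ℂ) (dz j (dzbar k (toC r)) q) = dz k (dzbar j (toC r)) q := by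
    intro j k
    rw [dz_dzbar_eq hr' k j,
      ← dzbar_conj (differentiableAt_of_smooth (contDiffAt_dzbar hr' k))]
    apply dzbar_congr
    filter_upwards [eventually_smooth hr] with x hx
    rw [dzbar_toC hx, Complex.conj_conj]
  simp only [complexHessian, Fin.sum_univ_two, map_add, map_mul, key, Complex.conj_conj]
  ring

/-! ### Hermitian algebra of the Levi form -/

theorem complexHessian_add_left (r : C2 → ℝ) (q ξ ξ' η : C2) :
    complexHessian r q (ξ + ξ') η = complexHessian r q ξ η + complexHessian r q ξ' η := by
  simp [complexHessian]; ring

theorem complexHessian_add_right (r : C2 → ℝ) (q ξ η η' : C2) :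
    complexHessian r q ξ (η + η') = complexHessian r q ξ η + complexHessian r q ξ η' := by
  simp [complexHessian]; ring

theorem complexHessian_smul_left (r : C2 → ℝ) (q ξ η : C2) (a : ℂ) :
    complexHessian r q (a • ξ) η = a * complexHessian r q ξ η := by
  simp [complexHessian]; ring

theorem complexHessian_smul_right (r : C2 → ℝ) (q ξ η : C2) (a : ℂ) :
    complexHessian r q ξ (a • η) = (starRingEnd ℂ) a * complexHessian r q ξ η := by
  simp [complexHessian]; ring

theorem leviForm_combination {r : C2 → ℝ} {q : C2} (hr : ContDiffAt ℝ ∞ r q) (ξ η : C2)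
    (a b : ℂ) :
    leviForm r q (a • ξ + b • η) = ‖a‖ ^ 2 * leviForm r q ξ
      + 2 * (a * (starRingEnd ℂ) b * complexHessian r q ξ η).re + ‖b‖ ^ 2 * leviForm r q η := by
  have h := conj_complexHessian hr ξ η
  simp only [leviForm, complexHessian_add_left, complexHessian_add_right,
    complexHessian_smul_left, complexHessian_smul_right, ← h]
  rw [← Complex.normSq_eq_norm_sq, ← Complex.normSq_eq_norm_sq]
  simp [Complex.normSq_apply]
  ring

theorem leviForm_combination_nonneg {r : C2 → ℝ} {q : C2} (hr : ContDiffAt ℝ ∞ r q) {ξ η : C2}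
    (h0 : 0 ≤ leviForm r q ξ) (h1 : 0 ≤ leviForm r q η)
    (h : ‖complexHessian r q ξ η‖ ^ 2 ≤ leviForm r q ξ * leviForm r q η) (a b : ℂ) :
    0 ≤ leviForm r q (a • ξ + b • η) := by
  rw [leviForm_combination hr]
  set A := leviForm r q ξ
  set D := leviForm r q η
  set B := complexHessian r q ξ η
  have hB : ‖B‖ ≤ √A * √D := by
    rw [← Real.sqrt_mul h0]
    exact Real.le_sqrt_of_sq_le h
  have h2 : |(a * (starRingEnd ℂ) b * B).re| ≤ ‖a‖ * ‖b‖ * ‖B‖ := by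
    refine (Complex.abs_re_le_norm _).trans ?_
    simp
  have h3 : ‖a‖ * ‖b‖ * ‖B‖ ≤ ‖a‖ * ‖b‖ * (√A * √D) := by gcongr
  have h4 := neg_abs_le (a * (starRingEnd ℂ) b * B).re
  have h5 := Real.sq_sqrt h0
  have h6 := Real.sq_sqrt h1
  nlinarith [sq_nonneg (‖a‖ * √A - ‖b‖ * √D)]

theorem norm_complexHessian_sq_le {r : C2 → ℝ} {q : C2} (hr : ContDiffAt ℝ ∞ r q)
    (hpos : ∀ ξ, 0 ≤ leviForm r q ξ) (ξ η : C2) :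
    ‖complexHessian r q ξ η‖ ^ 2 ≤ leviForm r q ξ * leviForm r q η := by
  set B := complexHessian r q ξ η with hB
  have key : ∀ t : ℝ, 0 ≤ leviForm r q ξ * (t * t) + (2 * ‖B‖ ^ 2) * t
      + ‖B‖ ^ 2 * leviForm r q η := by
    intro t
    -- The coefficient B on η makes the cross term the real number t‖B‖²; the discriminant in t then
    -- carries a spare factor ‖B‖².
    have h := hpos ((t : ℂ) • ξ + B • η)
    rw [leviForm_combination hr, ← hB] at h
    have e : ((t : ℂ) * (starRingEnd ℂ) B * B).re = t * ‖B‖ ^ 2 := by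
      rw [mul_assoc, mul_comm ((starRingEnd ℂ) B), Complex.mul_conj,
        Complex.normSq_eq_norm_sq, ← Complex.ofReal_mul, Complex.ofReal_re]
    rw [e, Complex.norm_real, Real.norm_eq_abs, sq_abs] at h
    linarith
  have hd := discrim_le_zero key
  rw [discrim] at hd
  rcases (norm_nonneg B).eq_or_lt with h0 | h0
  · rw [← h0]
    simpa using mul_nonneg (hpos ξ) (hpos η)
  · have : 0 < ‖B‖ ^ 2 := by positivity
    nlinarith

/-! ### The unitary frame L, N -/

/-- The factor `√2 / |∂r|` normalizing the frame `L`, `N`. -/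
def frameScale (r : C2 → ℝ) (q : C2) : ℝ := √2 / normDel r q

theorem normDel_pos {r : C2 → ℝ} {q : C2} (hr : DifferentiableAt ℝ r q)
    (h : fderiv ℝ r q ≠ 0) : 0 < normDel r q := by
  apply Real.sqrt_pos.2
  by_contra hn
  have h0 : dz 0 (toC r) q = 0 := by
    rw [← norm_eq_zero]
    nlinarith [sq_nonneg ‖dz 0 (toC r) q‖, sq_nonneg ‖dz 1 (toC r) q‖]
  have h1 : dz 1 (toC r) q = 0 := by
    rw [← norm_eq_zero]
    nlinarith [sq_nonneg ‖dz 0 (toC r) q‖, sq_nonneg ‖dz 1 (toC r) q‖]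
  apply h
  ext v
  rw [fderiv_eq_delPairing hr]
  simp [delPairing, Fin.sum_univ_two, h0, h1]

theorem frameScale_pos {r : C2 → ℝ} {q : C2} (hr : DifferentiableAt ℝ r q)
    (h : fderiv ℝ r q ≠ 0) : 0 < frameScale r q :=
  div_pos (by positivity) (normDel_pos hr h)

theorem frameScale_sq {r : C2 → ℝ} {q : C2} (hr : DifferentiableAt ℝ r q)
    (h : fderiv ℝ r q ≠ 0) :
    (frameScale r q : ℂ) ^ 2 * (dz 0 (toC r) q * (starRingEnd ℂ) (dz 0 (toC r) q)
      + dz 1 (toC r) q * (starRingEnd ℂ) (dz 1 (toC r) q)) = 1 := by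
  have hp := normDel_pos hr h
  have h2 : normDel r q ^ 2 = 2 * (‖dz 0 (toC r) q‖ ^ 2 + ‖dz 1 (toC r) q‖ ^ 2) :=
    Real.sq_sqrt (by positivity)
  have h3 : frameScale r q ^ 2 * (‖dz 0 (toC r) q‖ ^ 2 + ‖dz 1 (toC r) q‖ ^ 2) = 1 := by
    rw [frameScale, div_pow, Real.sq_sqrt (by norm_num), div_mul_eq_mul_div, ← h2,
      div_self (by positivity)]
  rw [Complex.mul_conj, Complex.mul_conj, Complex.normSq_eq_norm_sq, Complex.normSq_eq_norm_sq]
  exact_mod_cast h3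

theorem vecL_zero (r : C2 → ℝ) (q : C2) : vecL r q 0 = frameScale r q * dz 1 (toC r) q := by
  simp [vecL, frameScale]

theorem vecL_one (r : C2 → ℝ) (q : C2) : vecL r q 1 = -(frameScale r q * dz 0 (toC r) q) := by
  simp [vecL, frameScale]

theorem vecN_apply {r : C2 → ℝ} {q : C2} (hr : DifferentiableAt ℝ r q) (j : Fin 2) :
    vecN r q j = frameScale r q * (starRingEnd ℂ) (dz j (toC r) q) := by
  fin_cases j <;> simp [vecN, frameScale, dzbar_toC hr]

theorem delPairing_vecL (r : C2 → ℝ) (q : C2) : delPairing r q (vecL r q) = 0 := by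
  simp only [delPairing, Fin.sum_univ_two, vecL_zero, vecL_one]
  ring

theorem frameScale_mul_delPairing_vecN {r : C2 → ℝ} {q : C2} (hr : DifferentiableAt ℝ r q)
    (h : fderiv ℝ r q ≠ 0) :
    (frameScale r q : ℂ) * delPairing r q (vecN r q) = 1 := by
  rw [← frameScale_sq hr h]
  simp only [delPairing, Fin.sum_univ_two, vecN_apply hr]
  ring

/-- The Hermitian pairing `∑ ξʲ conj(ηʲ)`. -/
def hermPairing (ξ η : C2) : ℂ := ∑ j, ξ j * (starRingEnd ℂ) (η j)

theorem hermPairing_vecL_vecL {r : C2 → ℝ} {q : C2} (hr : DifferentiableAt ℝ r q)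
    (h : fderiv ℝ r q ≠ 0) : hermPairing (vecL r q) (vecL r q) = 1 := by
  rw [← frameScale_sq hr h]
  simp only [hermPairing, Fin.sum_univ_two, vecL_zero, vecL_one, map_mul, map_neg,
    Complex.conj_ofReal]
  ring

theorem hermPairing_vecN_vecN {r : C2 → ℝ} {q : C2} (hr : DifferentiableAt ℝ r q)
    (h : fderiv ℝ r q ≠ 0) : hermPairing (vecN r q) (vecN r q) = 1 := by
  rw [← frameScale_sq hr h]
  simp only [hermPairing, Fin.sum_univ_two, vecN_apply hr, map_mul, Complex.conj_conj,
    Complex.conj_ofReal]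
  ring

theorem hermPairing_vecL_vecN {r : C2 → ℝ} {q : C2} (hr : DifferentiableAt ℝ r q) :
    hermPairing (vecL r q) (vecN r q) = 0 := by
  simp only [hermPairing, Fin.sum_univ_two, vecN_apply hr, vecL_zero, vecL_one, map_mul,
    Complex.conj_conj, Complex.conj_ofReal]
  ring

theorem hermPairing_self (ξ : C2) : hermPairing ξ ξ = (‖ξ‖ ^ 2 : ℝ) := by
  simp [hermPairing, EuclideanSpace.norm_sq_eq, Fin.sum_univ_two, Complex.mul_conj,
    Complex.normSq_eq_norm_sq]

theorem norm_vecN {r : C2 → ℝ} {q : C2} (hr : DifferentiableAt ℝ r q)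
    (h : fderiv ℝ r q ≠ 0) : ‖vecN r q‖ = 1 := by
  have h1 := hermPairing_vecN_vecN hr h
  rw [hermPairing_self] at h1
  have h2 : ‖vecN r q‖ ^ 2 = 1 := by exact_mod_cast h1
  exact (pow_eq_one_iff_of_nonneg (norm_nonneg _) two_ne_zero).1 h2

theorem exists_frame_coeffs {r : C2 → ℝ} {q : C2} (hr : DifferentiableAt ℝ r q)
    (h : fderiv ℝ r q ≠ 0) (ξ : C2) : ∃ a b : ℂ, ξ = a • vecL r q + b • vecN r q := by
  refine ⟨hermPairing ξ (vecL r q), hermPairing ξ (vecN r q), ?_⟩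
  have hs := frameScale_sq hr h
  ext j
  fin_cases j
  · simp only [hermPairing, Fin.sum_univ_two, vecN_apply hr, vecL_zero, vecL_one, map_mul,
      map_neg, Complex.conj_conj, Complex.conj_ofReal, PiLp.add_apply, PiLp.smul_apply,
      smul_eq_mul, Fin.zero_eta]
    linear_combination (-ξ 0) * hs
  · simp only [hermPairing, Fin.sum_univ_two, vecN_apply hr, vecL_zero, vecL_one, map_mul,
      map_neg, Complex.conj_conj, Complex.conj_ofReal, PiLp.add_apply, PiLp.smul_apply,
      smul_eq_mul, Fin.mk_one]
    linear_combination (-ξ 1) * hs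

theorem real_inner_eq (v w : C2) : inner ℝ v w = (hermPairing w v).re := by
  simp [hermPairing, PiLp.inner_apply, Complex.inner, Fin.sum_univ_two]

/-- N, read as a real vector, is the unit normal ν. This form of the gradient turns a Lagrange
multiplier equation into parallelism with ν. -/
theorem fderiv_eq_inner_vecN {r : C2 → ℝ} {q : C2} (hr : DifferentiableAt ℝ r q)
    (v : C2) :
    frameScale r q * fderiv ℝ r q v = 2 * inner ℝ (vecN r q) v := by
  have e : hermPairing v (vecN r q) = frameScale r q * delPairing r q v := by
    simp only [hermPairing, delPairing, Fin.sum_univ_two, vecN_apply hr, map_mul,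
      Complex.conj_conj, Complex.conj_ofReal]
    ring
  rw [fderiv_eq_delPairing hr, real_inner_eq, e, Complex.re_ofReal_mul]
  ring

theorem contDiffAt_frameScale {r : C2 → ℝ} {q : C2} (hr : ContDiffAt ℝ ∞ r q)
    (h : fderiv ℝ r q ≠ 0) : ContDiffAt ℝ ∞ (frameScale r) q := by
  have hp := normDel_pos (differentiableAt_of_smooth hr) h
  have hd : ∀ j, ContDiffAt ℝ ∞ (fun x => ‖dz j (toC r) x‖ ^ 2) q := fun j =>
    (contDiffAt_dz (contDiffAt_toC hr) j).norm_sq ℝ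
  refine contDiffAt_const.div ?_ hp.ne'
  refine ContDiffAt.sqrt (contDiffAt_const.mul ((hd 0).add (hd 1))) ?_
  exact (Real.sqrt_pos.1 hp).ne'

theorem contDiffAt_vecL {r : C2 → ℝ} {q : C2} (hr : ContDiffAt ℝ ∞ r q)
    (h : fderiv ℝ r q ≠ 0) : ContDiffAt ℝ ∞ (vecL r) q := by
  have hd := fun j => contDiffAt_dz (contDiffAt_toC hr) j
  refine (contDiffAt_frameScale hr h).smul ?_
  rw [contDiffAt_piLp 2]
  intro i
  fin_cases i
  · simpa using hd 1
  · simpa using (hd 0).neg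

theorem contDiffAt_vecN {r : C2 → ℝ} {q : C2} (hr : ContDiffAt ℝ ∞ r q)
    (h : fderiv ℝ r q ≠ 0) : ContDiffAt ℝ ∞ (vecN r) q := by
  have hd := fun j => contDiffAt_dzbar (contDiffAt_toC hr) j
  refine (contDiffAt_frameScale hr h).smul ?_
  rw [contDiffAt_piLp 2]
  intro i
  fin_cases i
  · simpa using hd 0
  · simpa using hd 1

theorem contDiffAt_coord {X : C2 → C2} {q : C2} (hX : ContDiffAt ℝ ∞ X q) (j : Fin 2) :
    ContDiffAt ℝ ∞ (fun x => X x j) q :=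
  ((EuclideanSpace.proj j : C2 →L[ℂ] ℂ).restrictScalars ℝ).contDiff.contDiffAt.comp q hX

theorem contDiffAt_delPairing {r : C2 → ℝ} {X : C2 → C2} {q : C2} (hr : ContDiffAt ℝ ∞ r q)
    (hX : ContDiffAt ℝ ∞ X q) : ContDiffAt ℝ ∞ (fun x => delPairing r x (X x)) q :=
  ContDiffAt.sum fun j _ => (contDiffAt_dz (contDiffAt_toC hr) j).mul (contDiffAt_coord hX j)

theorem contDiffAt_complexHessian {r : C2 → ℝ} {X Y : C2 → C2} {q : C2}
    (hr : ContDiffAt ℝ ∞ r q) (hX : ContDiffAt ℝ ∞ X q) (hY : ContDiffAt ℝ ∞ Y q) :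
    ContDiffAt ℝ ∞ (fun x => complexHessian r x (X x) (Y x)) q :=
  ContDiffAt.sum fun j _ => ContDiffAt.sum fun k _ =>
    ((contDiffAt_dz (contDiffAt_dzbar (contDiffAt_toC hr) k) j).mul (contDiffAt_coord hX j)).mul
      ((Complex.conjCLE : ℂ →L[ℝ] ℂ).contDiff.contDiffAt.comp q (contDiffAt_coord hY k))

theorem contDiffAt_leviForm {r : C2 → ℝ} {X : C2 → C2} {q : C2}
    (hr : ContDiffAt ℝ ∞ r q) (hX : ContDiffAt ℝ ∞ X q) :
    ContDiffAt ℝ ∞ (fun x => leviForm r x (X x)) q :=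
  Complex.reCLM.contDiff.contDiffAt.comp q (contDiffAt_complexHessian hr hX hX)

theorem contDiffAt_hessLL {r : C2 → ℝ} {q : C2} (hr : ContDiffAt ℝ ∞ r q)
    (h : fderiv ℝ r q ≠ 0) : ContDiffAt ℝ ∞ (hessLL r) q :=
  contDiffAt_leviForm hr (contDiffAt_vecL hr h)

theorem contDiffAt_hessLN {r : C2 → ℝ} {q : C2} (hr : ContDiffAt ℝ ∞ r q)
    (h : fderiv ℝ r q ≠ 0) : ContDiffAt ℝ ∞ (hessLN r) q :=
  contDiffAt_complexHessian hr (contDiffAt_vecL hr h) (contDiffAt_vecN hr h)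

/-! ### The squared distance, and uniform bounds on compact sets -/

theorem contDiff_norm_sub_sq (p : C2) : ContDiff ℝ ∞ (fun x : C2 => ‖x - p‖ ^ 2) :=
  (contDiff_id.sub contDiff_const).norm_sq ℝ

theorem hasStrictFDerivAt_norm_sub_sq (p q : C2) :
    HasStrictFDerivAt (fun x : C2 => ‖x - p‖ ^ 2) (2 • (innerSL ℝ (q - p))) q := by
  have := (hasStrictFDerivAt_norm_sq (q - p)).comp q
    ((hasStrictFDerivAt_id (𝕜 := ℝ) q).sub_const p)
  simpa using this

theorem dz_norm_sub_sq (p q : C2) (j : Fin 2) :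
    dz j (toC fun x => ‖x - p‖ ^ 2) q = (starRingEnd ℂ) ((q - p) j) := by
  have hd := (hasStrictFDerivAt_norm_sub_sq p q).hasFDerivAt
  simp only [dz, fderiv_toC hd.differentiableAt, hd.fderiv, smul_apply, innerSL_apply_apply,
    real_inner_eq, hermPairing, Fin.sum_univ_two]
  apply Complex.ext <;> fin_cases j <;> simp <;> ring

theorem complexHessian_norm_sub_sq (p q ξ η : C2) :
    complexHessian (fun x => ‖x - p‖ ^ 2) q ξ η = hermPairing ξ η := by
  have hd : ∀ x, DifferentiableAt ℝ (fun x : C2 => ‖x - p‖ ^ 2) x := fun x =>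
    (hasStrictFDerivAt_norm_sub_sq p x).hasFDerivAt.differentiableAt
  have e : ∀ k, dzbar k (toC fun x => ‖x - p‖ ^ 2) = fun x : C2 => (x - p) k := by
    intro k
    ext x
    rw [dzbar_toC (hd x), dz_norm_sub_sq, Complex.conj_conj]
  have hk : ∀ k v, fderiv ℝ (fun x : C2 => (x - p) k) q v = v k := by
    intro k v
    have : HasFDerivAt (fun x : C2 => (x - p) k)
        ((EuclideanSpace.proj k : C2 →L[ℂ] ℂ).restrictScalars ℝ) q :=
      ((EuclideanSpace.proj k : C2 →L[ℂ] ℂ).restrictScalars ℝ).hasFDerivAt.comp q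
        ((hasFDerivAt_id (𝕜 := ℝ) q).sub_const p)
    rw [this.fderiv]; rfl
  simp only [complexHessian, e, dz, hk, hermPairing, Fin.sum_univ_two]
  simp
  ring

theorem exists_norm_bound {E : Type*} [NormedAddCommGroup E] [NormedSpace ℝ E] {F : C2 → E}
    {B : Set C2} (hB : IsCompact B) (hF : ∀ x ∈ B, ContDiffAt ℝ ∞ F x) :
    ∃ C : ℝ, 0 < C ∧ ∀ x ∈ B, ‖F x‖ ≤ C := by
  obtain ⟨C, hC⟩ := hB.exists_bound_of_continuousOn
    (f := F) fun x hx => (hF x hx).continuousAt.continuousWithinAt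
  exact ⟨max C 1, by positivity, fun x hx => (hC x hx).trans (le_max_left _ _)⟩

theorem exists_lipschitz_bound {E : Type*} [NormedAddCommGroup E] [NormedSpace ℝ E] {F : C2 → E}
    {B : Set C2} (hB : IsCompact B) (hc : Convex ℝ B) (hF : ∀ x ∈ B, ContDiffAt ℝ ∞ F x) :
    ∃ C : ℝ, 0 < C ∧ ∀ p ∈ B, ∀ q ∈ B, ‖F q - F p‖ ≤ C * ‖q - p‖ := by
  obtain ⟨K, hK⟩ := ContDiffOn.exists_lipschitzOnWith (n := ∞)
    (fun x hx => (hF x hx).contDiffWithinAt) (by simp) hc hB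
  refine ⟨K + 1, by positivity, fun p hp q hq => (hK.norm_sub_le hq hp).trans ?_⟩
  gcongr
  linarith

/-- Mean value inequality on the segment, with the derivative Lipschitz on `B`; the sharp factor 1/2
is not needed. -/
theorem exists_taylor_bound {f : C2 → ℝ} {B : Set C2} (hB : IsCompact B) (hc : Convex ℝ B)
    (hf : ∀ x ∈ B, ContDiffAt ℝ ∞ f x) :
    ∃ C : ℝ, 0 < C ∧ ∀ p ∈ B, ∀ q ∈ B,
      |f q - f p - fderiv ℝ f p (q - p)| ≤ C * ‖q - p‖ ^ 2 := by
  obtain ⟨C, hC, h⟩ := exists_lipschitz_bound (F := fderiv ℝ f) hB hc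
    fun x hx => (hf x hx).fderiv_right (by simp)
  refine ⟨C, hC, fun p hp q hq => ?_⟩
  have hsub : segment ℝ p q ⊆ B := hc.segment_subset hp hq
  have := Convex.norm_image_sub_le_of_norm_fderiv_le' (𝕜 := ℝ) (f := f) (φ := fderiv ℝ f p)
    (C := C * ‖q - p‖) (s := segment ℝ p q) (x := p) (y := q)
    (fun x hx => differentiableAt_of_smooth (hf x (hsub hx)))
    (fun x hx => (h p hp x (hsub hx)).trans
      (mul_le_mul_of_nonneg_left (norm_sub_le_of_mem_segment hx) hC.le))
    (convex_segment p q) (left_mem_segment ℝ p q) (right_mem_segment ℝ p q)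
  rw [sq, ← mul_assoc]
  exact this

/-- The derivative of a nonnegative function is controlled by the square root of the function. -/
theorem exists_sq_fderiv_le {f : C2 → ℝ} {p : C2} {R : ℝ} (hR : 0 < R)
    (hf : ∀ x ∈ Metric.closedBall p (2 * R), ContDiffAt ℝ ∞ f x)
    (hpos : ∀ x ∈ Metric.closedBall p (2 * R), 0 ≤ f x) :
    ∃ C : ℝ, 0 < C ∧ ∀ q ∈ Metric.closedBall p R, ∀ v : C2, ‖v‖ = 1 →
      (fderiv ℝ f q v) ^ 2 ≤ C * f q := by
  have hsub : Metric.closedBall p R ⊆ Metric.closedBall p (2 * R) :=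
    Metric.closedBall_subset_closedBall (by linarith)
  obtain ⟨C, hC, hT⟩ := exists_taylor_bound (isCompact_closedBall p (2 * R))
    (convex_closedBall p (2 * R)) hf
  obtain ⟨D, hD, hB⟩ := exists_norm_bound (F := fderiv ℝ f) (isCompact_closedBall p (2 * R))
    fun x hx => (hf x hx).fderiv_right (by simp)
  -- `C` dominates the Taylor remainder; `D / R` keeps the step `t` below no more than `R` in size,
  -- so the moved point stays in the larger ball.
  set A := C + D / R with hA
  have hApos : 0 < A := by positivity
  refine ⟨4 * A, by positivity, fun q hq v hv => ?_⟩
  set g := fderiv ℝ f q v with hg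
  have hgD : |g| ≤ D := by
    have := (fderiv ℝ f q).le_opNorm v
    rw [hv, mul_one] at this
    exact this.trans (hB q (hsub hq))
  -- The minimizer of t g + A t²; nonnegativity of f at the moved point bounds g².
  set t : ℝ := -(g / (2 * A)) with ht
  have htR : |t| ≤ R := by
    rw [ht, abs_neg, abs_div, abs_of_pos (by positivity : 0 < 2 * A),
      div_le_iff₀ (by positivity)]
    have : R * (2 * A) = 2 * R * C + 2 * D := by
      rw [hA]; field_simp
    nlinarith [mul_pos hR hC]
  have hq' : q + t • v ∈ Metric.closedBall p (2 * R) := by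
    rw [Metric.mem_closedBall, dist_eq_norm] at hq ⊢
    calc ‖q + t • v - p‖ = ‖(q - p) + t • v‖ := by congr 1; abel
      _ ≤ ‖q - p‖ + ‖t • v‖ := norm_add_le _ _
      _ ≤ R + R := by
        gcongr
        rwa [norm_smul, hv, mul_one]
      _ = 2 * R := by ring
  have h1 := hT q (hsub hq) _ hq'
  rw [add_sub_cancel_left, map_smul, smul_eq_mul, ← hg, norm_smul, hv, mul_one,
    Real.norm_eq_abs, sq_abs] at h1
  have h2 := (abs_le.1 h1).2
  have h3 := hpos _ hq'
  have h4 : C * t ^ 2 ≤ A * t ^ 2 := by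
    gcongr
    rw [hA]
    have : 0 < D / R := by positivity
    linarith
  have h5 : t * g + A * t ^ 2 = -(g ^ 2 / (4 * A)) := by
    rw [ht]; field_simp; ring
  have h6 : g ^ 2 / (4 * A) ≤ f q := by linarith
  rw [div_le_iff₀ (by positivity)] at h6
  linarith

/-! ### From the boundary to a neighborhood -/

/-- Points near `p₀` lie on the normal line of a point of the hypersurface `r = 0`, at a distance
comparable to `|r|`. -/
theorem exists_normal_projection {r : C2 → ℝ} {p₀ : C2} {R : ℝ} (hR : 0 < R) (h0 : r p₀ = 0)
    (hr : ∀ x ∈ Metric.closedBall p₀ R, ContDiffAt ℝ ∞ r x)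
    (hd : ∀ x ∈ Metric.closedBall p₀ R, fderiv ℝ r x ≠ 0) :
    ∃ C : ℝ, 0 < C ∧ ∃ δ : ℝ, 0 < δ ∧ δ ≤ R ∧ ∀ q ∈ Metric.ball p₀ δ,
      ∃ p ∈ Metric.closedBall p₀ R, r p = 0 ∧
        ∃ s : ℝ, q - p = s • vecN r p ∧ |s| ≤ C * |r q| := by
  have hK := isCompact_closedBall p₀ R
  obtain ⟨C, hC, hT⟩ := exists_taylor_bound hK (convex_closedBall p₀ R) hr
  obtain ⟨D, hD, hB⟩ := exists_norm_bound (F := frameScale r) hK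
    fun x hx => contDiffAt_frameScale (hr x hx) (hd x hx)
  -- `R / 2` puts the nearest point in the open ball, where it is a genuine constrained local
  -- minimum; `1 / (C * D)` lets the quadratic Taylor term be absorbed in |s|.
  refine ⟨D, hD, min (R / 2) (1 / (C * D)), by positivity,
    (min_le_left _ _).trans (by linarith), fun q hq => ?_⟩
  have hq1 : dist q p₀ < R / 2 := (Metric.mem_ball.1 hq).trans_le (min_le_left _ _)
  have hq2 : dist q p₀ < 1 / (C * D) := (Metric.mem_ball.1 hq).trans_le (min_le_right _ _)
  set Z : Set C2 := Metric.closedBall p₀ R ∩ r ⁻¹' {0} with hZ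
  have hcont : ContinuousOn r (Metric.closedBall p₀ R) := fun x hx =>
    (hr x hx).continuousAt.continuousWithinAt
  have hZc : IsCompact Z :=
    hK.of_isClosed_subset (hcont.preimage_isClosed_of_isClosed Metric.isClosed_closedBall
      isClosed_singleton) Set.inter_subset_left
  have hZ0 : p₀ ∈ Z := ⟨Metric.mem_closedBall_self hR.le, h0⟩
  obtain ⟨p, hpZ, hmin⟩ := hZc.exists_isMinOn ⟨p₀, hZ0⟩
    (f := fun x => ‖x - q‖ ^ 2) (by fun_prop)
  have hpq : ‖p - q‖ ≤ dist q p₀ := by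
    rw [dist_comm, dist_eq_norm]
    exact (sq_le_sq₀ (norm_nonneg _) (norm_nonneg _)).1 (hmin hZ0)
  have hp0 : r p = 0 := hpZ.2
  have hpball : p ∈ Metric.ball p₀ R := by
    rw [Metric.mem_ball]
    have := dist_triangle p q p₀
    rw [dist_eq_norm p q] at this
    linarith
  have hdiff := differentiableAt_of_smooth (hr p hpZ.1)
  have hloc : IsLocalExtrOn (fun x => ‖x - q‖ ^ 2) {x | r x = r p} p := by
    left
    have : ∀ᶠ x in 𝓝[{x | r x = r p}] p, x ∈ Z := by
      filter_upwards [self_mem_nhdsWithin,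
        mem_nhdsWithin_of_mem_nhds (Metric.isOpen_ball.mem_nhds hpball)] with x hx hx'
      exact ⟨Metric.ball_subset_closedBall hx', hx.trans hp0⟩
    filter_upwards [this] with x hx
    exact hmin hx
  obtain ⟨a, b, hab, hlag⟩ := hloc.exists_multipliers_of_hasStrictFDerivAt_1d
    ((hr p hpZ.1).hasStrictFDerivAt (by simp)) (hasStrictFDerivAt_norm_sub_sq q p)
  have hb : b ≠ 0 := by
    rintro rfl
    rw [zero_smul, add_zero, smul_eq_zero] at hlag
    exact hab (by rw [hlag.resolve_right (hd p hpZ.1)]; rfl)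
  have hs := frameScale_pos hdiff (hd p hpZ.1)
  set σ := frameScale r p with hσ
  -- Since σ dr = 2⟨N, ·⟩ at p, the multiplier equation reads (a/σ) N = b (q - p).
  set s : ℝ := a / (b * σ) with hsdef
  have hnormal : q - p = s • vecN r p := by
    refine ext_inner_right ℝ fun v => ?_
    have h1 := fderiv_eq_inner_vecN hdiff v
    have h2 : a * fderiv ℝ r p v + b * (2 * inner ℝ (p - q) v) = 0 := by
      have := congrArg (fun l : C2 →L[ℝ] ℝ => l v) hlag
      simpa [inner_sub_left] using this
    rw [← neg_sub p q, inner_neg_left, real_inner_smul_left, hsdef, div_mul_eq_mul_div,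
      eq_div_iff (by positivity)]
    linear_combination (a / 2) * h1 - σ / 2 * h2
  refine ⟨p, hpZ.1, hp0, s, hnormal, ?_⟩
  have hN := norm_vecN hdiff (hd p hpZ.1)
  have hsn : |s| = ‖q - p‖ := by rw [hnormal, norm_smul, hN, mul_one, Real.norm_eq_abs]
  have h1 := hT p hpZ.1 q (Metric.mem_closedBall.2 (by linarith))
  have h2 : σ * fderiv ℝ r p (q - p) = 2 * s := by
    rw [fderiv_eq_inner_vecN hdiff, hnormal, real_inner_smul_right,
      real_inner_self_eq_norm_sq, hN]
    ring
  rw [hp0, sub_zero, ← hsn] at h1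
  have h3 : |s| < 1 / (C * D) := by
    rw [hsn, norm_sub_rev]; linarith
  rw [lt_div_iff₀ (by positivity)] at h3
  have h4 : σ ≤ D := (le_abs_self _).trans (hB p hpZ.1)
  have h5 : 2 * |s| ≤ σ * (|r q| + C * |s| ^ 2) := by
    have : |fderiv ℝ r p (q - p)| ≤ |r q| + C * |s| ^ 2 := by
      have := abs_sub_abs_le_abs_sub (fderiv ℝ r p (q - p)) (r q)
      rw [abs_sub_comm] at this
      linarith
    calc 2 * |s| = |σ * fderiv ℝ r p (q - p)| := by rw [h2, abs_mul]; norm_num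
      _ = σ * |fderiv ℝ r p (q - p)| := by rw [abs_mul, abs_of_pos hs]
      _ ≤ _ := by gcongr
  have h6 : σ * (|r q| + C * |s| ^ 2) ≤ D * (|r q| + C * |s| ^ 2) := by gcongr
  nlinarith [abs_nonneg s]

/-- Both bounds at q are compared with the boundary value f(p) at the foot p of the normal: f(q) is
at least f(p)/2 - O(r²), and H_r(L,N) changes by O(|r|). -/
theorem exists_hessian_bounds {r : C2 → ℝ} {p₀ : C2} {R C₀ : ℝ} (hR : 0 < R) (h0 : r p₀ = 0)
    (hr : ∀ x ∈ Metric.closedBall p₀ R, ContDiffAt ℝ ∞ r x)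
    (hd : ∀ x ∈ Metric.closedBall p₀ R, fderiv ℝ r x ≠ 0) (hC₀ : 0 < C₀)
    (hpos : ∀ p ∈ Metric.closedBall p₀ R, r p = 0 → 0 ≤ hessLL r p)
    (hLN : ∀ p ∈ Metric.closedBall p₀ R, r p = 0 → ‖hessLN r p‖ ^ 2 ≤ C₀ * hessLL r p)
    (hν : ∀ p ∈ Metric.closedBall p₀ R, r p = 0 →
      nuDeriv r (hessLL r) p ^ 2 ≤ C₀ * hessLL r p) :
    ∃ C : ℝ, 0 < C ∧ ∃ δ : ℝ, 0 < δ ∧ δ ≤ R ∧ ∀ q ∈ Metric.ball p₀ δ,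
      0 ≤ hessLL r q + C * r q ^ 2 ∧
        ‖hessLN r q‖ ^ 2 ≤ C * (hessLL r q + C * r q ^ 2) := by
  have hK := isCompact_closedBall p₀ R
  have hcv := convex_closedBall p₀ R
  obtain ⟨C₁, hC₁, hT⟩ := exists_taylor_bound (f := hessLL r) hK hcv
    fun x hx => contDiffAt_hessLL (hr x hx) (hd x hx)
  obtain ⟨L, hL, hlip⟩ := exists_lipschitz_bound (F := hessLN r) hK hcv
    fun x hx => contDiffAt_hessLN (hr x hx) (hd x hx)
  obtain ⟨C₂, hC₂, δ, hδ, hδR, hproj⟩ := exists_normal_projection hR h0 hr hd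
  -- The `+ 1` leaves a spare r², which absorbs the Lipschitz error of H_r(L,N); `A + B` then serves
  -- both as defect and as factor.
  set A := (C₀ / 2 + C₁) * C₂ ^ 2 + 1 with hA
  set B := 4 * C₀ + 2 * L ^ 2 * C₂ ^ 2 with hB
  have hApos : 0 < A := by positivity
  have hBpos : 0 < B := by positivity
  refine ⟨A + B, by positivity, δ, hδ, hδR, fun q hq => ?_⟩
  obtain ⟨p, hp, hp0, s, hs, hsr⟩ := hproj q hq
  have hqB : q ∈ Metric.closedBall p₀ R :=
    Metric.mem_closedBall.2 ((Metric.mem_ball.1 hq).le.trans hδR)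
  have hN := norm_vecN (differentiableAt_of_smooth (hr p hp)) (hd p hp)
  have hsn : ‖q - p‖ = |s| := by rw [hs, norm_smul, hN, mul_one, Real.norm_eq_abs]
  have hs2 : s ^ 2 ≤ C₂ ^ 2 * r q ^ 2 := by
    rw [← mul_pow, sq_le_sq, abs_mul, abs_of_pos hC₂]
    exact hsr
  have hf := hpos p hp hp0
  have hderiv : fderiv ℝ (hessLL r) p (q - p) = s * nuDeriv r (hessLL r) p := by
    rw [hs, map_smul, smul_eq_mul, nuDeriv]
  have h1 := hT p hp q hqB
  rw [hderiv, hsn, sq_abs] at h1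
  have h1 := (abs_le.1 h1).1
  set f := hessLL r p with hfdef
  set g := nuDeriv r (hessLL r) p with hg
  -- Completing the square with g² ≤ C₀ f: here the condition on νH_r(L,L) enters.
  have h2 : -(f / 2 + C₀ / 2 * s ^ 2) ≤ s * g := by
    have := hν p hp hp0
    have h3 : 0 ≤ (g + C₀ * s) ^ 2 := sq_nonneg _
    nlinarith
  have h4 : (C₀ / 2 + C₁) * s ^ 2 ≤ (C₀ / 2 + C₁) * (C₂ ^ 2 * r q ^ 2) := by gcongr
  have h5 : f / 2 + r q ^ 2 ≤ hessLL r q + A * r q ^ 2 := by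
    rw [hA]; linarith
  have hBr : 0 ≤ B * r q ^ 2 := by positivity
  have h6 : f / 2 + r q ^ 2 ≤ hessLL r q + (A + B) * r q ^ 2 := by linarith
  have hr2 := sq_nonneg (r q)
  refine ⟨by linarith, ?_⟩
  have h7 : ‖hessLN r q‖ ≤ ‖hessLN r p‖ + L * |s| := by
    have := hlip p hp q hqB
    rw [hsn] at this
    have h8 := norm_sub_norm_le (hessLN r q) (hessLN r p)
    linarith
  have h8 := hLN p hp hp0
  have h9 : ‖hessLN r q‖ ^ 2 ≤ 2 * ‖hessLN r p‖ ^ 2 + 2 * (L ^ 2 * s ^ 2) := by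
    calc ‖hessLN r q‖ ^ 2 ≤ (‖hessLN r p‖ + L * |s|) ^ 2 := by gcongr
      _ ≤ 2 * ‖hessLN r p‖ ^ 2 + 2 * (L ^ 2 * |s| ^ 2) := by
        nlinarith [sq_nonneg (‖hessLN r p‖ - L * |s|)]
      _ = _ := by rw [sq_abs]
  have h10 : L ^ 2 * s ^ 2 ≤ L ^ 2 * (C₂ ^ 2 * r q ^ 2) := by gcongr
  have h11 : ‖hessLN r q‖ ^ 2 ≤ B * (f / 2 + r q ^ 2) := by
    rw [hB]
    have e1 : 0 ≤ 4 * C₀ * r q ^ 2 := by positivity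
    have e2 : 0 ≤ L ^ 2 * C₂ ^ 2 * f := by positivity
    nlinarith
  calc ‖hessLN r q‖ ^ 2 ≤ B * (f / 2 + r q ^ 2) := h11
    _ ≤ (A + B) * (f / 2 + r q ^ 2) := by gcongr; linarith
    _ ≤ _ := by gcongr

/-! ### The modified defining function and its Levi form -/

theorem delPairing_const (c : ℝ) (q ξ : C2) : delPairing (fun _ => c) q ξ = 0 := by
  have : toC (fun _ : C2 => c) = fun _ => (c : ℂ) := rfl
  simp [delPairing, dz, this]

theorem delPairing_add {f g : C2 → ℝ} {q : C2} (hf : DifferentiableAt ℝ f q)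
    (hg : DifferentiableAt ℝ g q) (ξ : C2) :
    delPairing (fun x => f x + g x) q ξ = delPairing f q ξ + delPairing g q ξ := by
  have h : toC (fun x => f x + g x) = fun x => toC f x + toC g x := by
    ext x; simp [toC]
  have hf' : DifferentiableAt ℝ (toC f) q := Complex.ofRealCLM.differentiableAt.comp q hf
  have hg' : DifferentiableAt ℝ (toC g) q := Complex.ofRealCLM.differentiableAt.comp q hg
  simp only [delPairing, h, dz_add hf' hg', Fin.sum_univ_two]
  ring

theorem complexHessian_const (c : ℝ) (q ξ η : C2) :
    complexHessian (fun _ => c) q ξ η = 0 := by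
  have : toC (fun _ : C2 => c) = fun _ => (c : ℂ) := rfl
  have h : ∀ k, dzbar k (fun _ : C2 => (c : ℂ)) = fun _ => 0 := by
    intro k; ext x; simp [dzbar]
  simp [complexHessian, this, h, dz]

/-- The weight `K + M |z - p|²`. -/
def weight (p : C2) (K M : ℝ) (x : C2) : ℝ := K + M * ‖x - p‖ ^ 2

theorem contDiff_weight (p : C2) (K M : ℝ) : ContDiff ℝ ∞ (weight p K M) :=
  contDiff_const.add (contDiff_const.mul (contDiff_norm_sub_sq p))

theorem delPairing_weight (p : C2) (K M : ℝ) (q ξ : C2) :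
    delPairing (weight p K M) q ξ = M * delPairing (fun x => ‖x - p‖ ^ 2) q ξ := by
  have h := differentiableAt_of_smooth (contDiff_norm_sub_sq p).contDiffAt (q := q)
  unfold weight
  rw [delPairing_add (differentiableAt_const K) (h.const_mul M),
    delPairing_mul (differentiableAt_const M) h, delPairing_const, delPairing_const]
  ring

theorem complexHessian_weight (p : C2) (K M : ℝ) (q ξ η : C2) :
    complexHessian (weight p K M) q ξ η = M * hermPairing ξ η := by
  have h := (contDiff_norm_sub_sq p).contDiffAt (x := q)
  unfold weight
  rw [complexHessian_add contDiffAt_const (contDiffAt_const.mul h),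
    complexHessian_mul contDiffAt_const h, complexHessian_const, complexHessian_const,
    complexHessian_norm_sub_sq, delPairing_const, delPairing_const]
  simp

/-- The modified defining function `r + φ r²`. -/
def modify (r φ : C2 → ℝ) (x : C2) : ℝ := r x + r x * (r x * φ x)

theorem contDiffAt_modify {r φ : C2 → ℝ} {q : C2} (hr : ContDiffAt ℝ ∞ r q)
    (hφ : ContDiffAt ℝ ∞ φ q) : ContDiffAt ℝ ∞ (modify r φ) q :=
  hr.add (hr.mul (hr.mul hφ))

theorem complexHessian_modify {r φ : C2 → ℝ} {q : C2} (hr : ContDiffAt ℝ ∞ r q)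
    (hφ : ContDiffAt ℝ ∞ φ q) (ξ η : C2) :
    complexHessian (modify r φ) q ξ η
      = ((1 + 2 * (r q * φ q) : ℝ) : ℂ) * complexHessian r q ξ η
        + (r q : ℂ) ^ 2 * complexHessian φ q ξ η
        + 2 * r q * (delPairing r q ξ * (starRingEnd ℂ) (delPairing φ q η)
          + delPairing φ q ξ * (starRingEnd ℂ) (delPairing r q η))
        + 2 * φ q * (delPairing r q ξ * (starRingEnd ℂ) (delPairing r q η)) := by
  have dr := differentiableAt_of_smooth hr
  have dφ := differentiableAt_of_smooth hφ
  unfold modify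
  rw [complexHessian_add hr (hr.mul (hr.mul hφ)), complexHessian_mul hr (hr.mul hφ),
    complexHessian_mul hr hφ, delPairing_mul dr dφ, delPairing_mul dr dφ]
  simp only [map_add, map_mul, Complex.conj_ofReal]
  push_cast
  ring

theorem fderiv_modify {r φ : C2 → ℝ} {q : C2} (hr : DifferentiableAt ℝ r q)
    (hφ : DifferentiableAt ℝ φ q) (h0 : r q = 0) :
    fderiv ℝ (modify r φ) q = fderiv ℝ r q := by
  unfold modify
  rw [fderiv_fun_add hr (hr.fun_mul (hr.fun_mul hφ)), fderiv_fun_mul hr (hr.fun_mul hφ),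
    fderiv_fun_mul hr hφ]
  simp [h0]

theorem norm_delPairing_vecN {r : C2 → ℝ} {q : C2} (hr : DifferentiableAt ℝ r q)
    (h : fderiv ℝ r q ≠ 0) : frameScale r q * ‖delPairing r q (vecN r q)‖ = 1 := by
  have := congrArg norm (frameScale_mul_delPairing_vecN hr h)
  rwa [norm_mul, Complex.norm_real, Real.norm_eq_abs, abs_of_pos (frameScale_pos hr h),
    norm_one] at this

theorem leviForm_modify_weight_vecL {r : C2 → ℝ} {q : C2} (hr : ContDiffAt ℝ ∞ r q)
    (h : fderiv ℝ r q ≠ 0) (p : C2) (K M : ℝ) :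
    leviForm (modify r (weight p K M)) q (vecL r q)
      = (1 + 2 * (r q * weight p K M q)) * hessLL r q + M * r q ^ 2 := by
  rw [leviForm, complexHessian_modify hr (contDiff_weight p K M).contDiffAt, delPairing_vecL,
    complexHessian_weight, hermPairing_vecL_vecL (differentiableAt_of_smooth hr) h, map_zero]
  have : ((r q : ℂ) ^ 2 * (M * 1)) = ((M * r q ^ 2 : ℝ) : ℂ) := by push_cast; ring
  rw [this]
  simp only [mul_zero, zero_mul, add_zero, Complex.add_re, Complex.ofReal_re,
    Complex.re_ofReal_mul]
  rfl

theorem complexHessian_modify_weight_vecL_vecN {r : C2 → ℝ} {q : C2} (hr : ContDiffAt ℝ ∞ r q)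
    (p : C2) (K M : ℝ) :
    complexHessian (modify r (weight p K M)) q (vecL r q) (vecN r q)
      = ((1 + 2 * (r q * weight p K M q) : ℝ) : ℂ) * hessLN r q
      + (2 * r q * M : ℝ) * (delPairing (fun x => ‖x - p‖ ^ 2) q (vecL r q)
        * (starRingEnd ℂ) (delPairing r q (vecN r q))) := by
  rw [complexHessian_modify hr (contDiff_weight p K M).contDiffAt, delPairing_vecL,
    complexHessian_weight, hermPairing_vecL_vecN (differentiableAt_of_smooth hr),
    delPairing_weight, delPairing_weight, hessLN]
  push_cast
  ring

theorem leviForm_modify_weight_vecN {r : C2 → ℝ} {q : C2} (hr : ContDiffAt ℝ ∞ r q)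
    (h : fderiv ℝ r q ≠ 0) (p : C2) (K M : ℝ) :
    leviForm (modify r (weight p K M)) q (vecN r q)
      = (1 + 2 * (r q * weight p K M q)) * leviForm r q (vecN r q) + M * r q ^ 2
      + 4 * M * (r q * (delPairing r q (vecN r q)
        * (starRingEnd ℂ) (delPairing (fun x => ‖x - p‖ ^ 2) q (vecN r q))).re)
      + 2 * (weight p K M q * ‖delPairing r q (vecN r q)‖ ^ 2) := by
  rw [leviForm, complexHessian_modify hr (contDiff_weight p K M).contDiffAt,
    complexHessian_weight, hermPairing_vecN_vecN (differentiableAt_of_smooth hr) h,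
    delPairing_weight, leviForm, ← Complex.normSq_eq_norm_sq, Complex.normSq_apply]
  simp [← Complex.ofReal_pow]
  ring

/-- The bound is free of K: L annihilates ∂r, and constants do not contribute to ∂φ, so K acts only
through 1 + 2rφ ≤ 2. This permits choosing K afterwards. -/
theorem norm_complexHessian_modify_sq_le {r : C2 → ℝ} {q p : C2} {K M C D : ℝ}
    (hr : ContDiffAt ℝ ∞ r q) (hsmall : |r q * weight p K M q| ≤ 1 / 4) (hC : 0 < C) (hM : 0 < M)
    (hLL : 0 ≤ hessLL r q + C * r q ^ 2)
    (hLN : ‖hessLN r q‖ ^ 2 ≤ C * (hessLL r q + C * r q ^ 2))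
    (hD : ‖delPairing (fun x => ‖x - p‖ ^ 2) q (vecL r q)‖ * ‖delPairing r q (vecN r q)‖ ≤ D) :
    ‖complexHessian (modify r (weight p K M)) q (vecL r q) (vecN r q)‖ ^ 2
      ≤ ((hessLL r q + C * r q ^ 2) / 2 + r q ^ 2) * (16 * C + 8 * (M * D) ^ 2) := by
  obtain ⟨hlo, hhi⟩ := abs_le.1 hsmall
  rw [complexHessian_modify_weight_vecL_vecN hr]
  set θ : ℝ := 1 + 2 * (r q * weight p K M q) with hθ
  have hθ1 : 0 < θ := by rw [hθ]; linarith
  have hθ2 : θ ≤ 2 := by rw [hθ]; linarith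
  set μ := hessLL r q + C * r q ^ 2
  set X := ‖hessLN r q‖
  have e1 : ‖(θ : ℂ) * hessLN r q + (2 * r q * M : ℝ) *
      (delPairing (fun x => ‖x - p‖ ^ 2) q (vecL r q)
        * (starRingEnd ℂ) (delPairing r q (vecN r q)))‖ ≤ 2 * X + 2 * (|r q| * (M * D)) := by
    refine (norm_add_le _ _).trans ?_
    rw [norm_mul, norm_mul, norm_mul, Complex.norm_real, Complex.norm_real, RCLike.norm_conj,
      Real.norm_eq_abs, Real.norm_eq_abs, abs_of_pos hθ1, abs_mul, abs_mul, abs_of_pos hM, abs_two]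
    have e3 := mul_le_mul_of_nonneg_left hD (by positivity : 0 ≤ 2 * |r q| * M)
    have e4 : θ * X ≤ 2 * X := mul_le_mul_of_nonneg_right hθ2 (norm_nonneg _)
    linarith
  have e2 : (2 * X + 2 * (|r q| * (M * D))) ^ 2 ≤ 8 * X ^ 2 + 8 * ((M * D) ^ 2 * r q ^ 2) := by
    rw [← sq_abs (r q)]
    nlinarith [sq_nonneg (X - |r q| * (M * D))]
  have e3 : 0 ≤ (M * D) ^ 2 * μ := by positivity
  have e4 : 0 ≤ C * r q ^ 2 := by positivity
  refine (pow_le_pow_left₀ (norm_nonneg _) e1 2).trans (e2.trans ?_)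
  linarith

/-- With θ = 1 + 2rφ ≤ 2, replacing f by μ - C r² costs at most 2C r²; the weight 2C + 1 pays for it
and leaves r². -/
theorem le_leviForm_modify_vecL {r : C2 → ℝ} {q p : C2} {K C : ℝ}
    (hr : ContDiffAt ℝ ∞ r q) (h : fderiv ℝ r q ≠ 0)
    (hsmall : |r q * weight p K (2 * C + 1) q| ≤ 1 / 4) (hC : 0 < C)
    (hLL : 0 ≤ hessLL r q + C * r q ^ 2) :
    (hessLL r q + C * r q ^ 2) / 2 + r q ^ 2
      ≤ leviForm (modify r (weight p K (2 * C + 1))) q (vecL r q) := by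
  obtain ⟨hlo, hhi⟩ := abs_le.1 hsmall
  rw [leviForm_modify_weight_vecL hr h]
  set θ : ℝ := 1 + 2 * (r q * weight p K (2 * C + 1) q) with hθ
  have e2 : 0 ≤ (θ - 1 / 2) * (hessLL r q + C * r q ^ 2) :=
    mul_nonneg (by rw [hθ]; linarith) hLL
  have e3 : 0 ≤ (2 - θ) * (C * r q ^ 2) := mul_nonneg (by rw [hθ]; linarith) (by positivity)
  linarith

theorem le_leviForm_modify_vecN {r : C2 → ℝ} {q p : C2} {K M B D S C : ℝ}
    (hr : ContDiffAt ℝ ∞ r q) (h : fderiv ℝ r q ≠ 0)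
    (hsmall : |r q * weight p K M q| ≤ 1 / 4) (hr1 : |r q| ≤ 1) (hM : 0 < M) (hC : 0 < C)
    (hB : |leviForm r q (vecN r q)| ≤ B)
    (hD : ‖delPairing r q (vecN r q)‖ * ‖delPairing (fun x => ‖x - p‖ ^ 2) q (vecN r q)‖ ≤ D)
    (hS : frameScale r q ≤ S) (hK : K = (2 * B + 4 * M * D + C) * S ^ 2) :
    C ≤ leviForm (modify r (weight p K M)) q (vecN r q) := by
  obtain ⟨hlo, hhi⟩ := abs_le.1 hsmall
  have dr := differentiableAt_of_smooth hr
  have hB0 : 0 ≤ B := (abs_nonneg _).trans hB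
  have hD0 : 0 ≤ D := le_trans (by positivity) hD
  rw [leviForm_modify_weight_vecN hr h]
  set θ : ℝ := 1 + 2 * (r q * weight p K M q) with hθ
  have hθ1 : 0 < θ := by rw [hθ]; linarith
  have hθ2 : θ ≤ 2 := by rw [hθ]; linarith
  set Y := (delPairing r q (vecN r q)
    * (starRingEnd ℂ) (delPairing (fun x => ‖x - p‖ ^ 2) q (vecN r q))).re with hY
  set T := ‖delPairing r q (vecN r q)‖ with hT
  have e1 : -(2 * B) ≤ θ * leviForm r q (vecN r q) := by
    have h2 : |θ * leviForm r q (vecN r q)| ≤ 2 * B := by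
      rw [abs_mul, abs_of_pos hθ1]
      exact mul_le_mul hθ2 hB (abs_nonneg _) (by norm_num)
    exact (abs_le.1 h2).1
  have e2 : -(4 * M * D) ≤ 4 * M * (r q * Y) := by
    have h1 : |Y| ≤ D := by
      refine (Complex.abs_re_le_norm _).trans ?_
      rwa [norm_mul, RCLike.norm_conj]
    have h2 : |r q * Y| ≤ 1 * D := by
      rw [abs_mul]
      exact mul_le_mul hr1 h1 (abs_nonneg _) zero_le_one
    have h3 := mul_le_mul_of_nonneg_left (abs_le.1 h2).1 (by positivity : 0 ≤ 4 * M)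
    linarith
  have e3 : 2 * B + 4 * M * D + C ≤ weight p K M q * T ^ 2 := by
    have h1 : K ≤ weight p K M q := by
      have : 0 ≤ M * ‖q - p‖ ^ 2 := by positivity
      rw [weight]
      linarith
    -- `S` bounds `frameScale`, so |∂r(N)| = `T` is at least 1/S; hence the factor S² in K.
    have h2 : 1 ≤ S * T := by
      rw [← norm_delPairing_vecN dr h]
      exact mul_le_mul_of_nonneg_right hS (norm_nonneg _)
    calc 2 * B + 4 * M * D + C ≤ (2 * B + 4 * M * D + C) * (S * T) ^ 2 :=
          le_mul_of_one_le_right (by positivity) (one_le_pow₀ h2)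
      _ = K * T ^ 2 := by rw [hK]; ring
      _ ≤ _ := mul_le_mul_of_nonneg_right h1 (sq_nonneg _)
  have e4 : 0 ≤ M * r q ^ 2 := by positivity
  have e5 : 0 ≤ M * D := by positivity
  linarith

theorem exists_leviForm_modify_nonneg {r : C2 → ℝ} {p₀ : C2} {R C : ℝ} (hR : 0 < R)
    (h0 : r p₀ = 0) (hr : ∀ x ∈ Metric.closedBall p₀ R, ContDiffAt ℝ ∞ r x)
    (hd : ∀ x ∈ Metric.closedBall p₀ R, fderiv ℝ r x ≠ 0) (hC : 0 < C)
    (hLL : ∀ q ∈ Metric.ball p₀ R, 0 ≤ hessLL r q + C * r q ^ 2)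
    (hLN : ∀ q ∈ Metric.ball p₀ R, ‖hessLN r q‖ ^ 2 ≤ C * (hessLL r q + C * r q ^ 2)) :
    ∃ K M δ : ℝ, 0 < δ ∧ δ ≤ R ∧ ∀ q ∈ Metric.ball p₀ δ,
      |r q * weight p₀ K M q| ≤ 1 / 4 ∧
        ∀ ξ, 0 ≤ leviForm (modify r (weight p₀ K M)) q ξ := by
  have hK := isCompact_closedBall p₀ R
  have hψ : ∀ x, ContDiffAt ℝ ∞ (fun x => ‖x - p₀‖ ^ 2) x := fun x =>
    (contDiff_norm_sub_sq p₀).contDiffAt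
  have sL := fun x hx => contDiffAt_vecL (hr x hx) (hd x hx)
  have sN := fun x hx => contDiffAt_vecN (hr x hx) (hd x hx)
  obtain ⟨B₁, hB₁, bNN⟩ := exists_norm_bound hK
    fun x hx => contDiffAt_leviForm (hr x hx) (sN x hx)
  obtain ⟨B₂, hB₂, bψL⟩ := exists_norm_bound hK
    fun x hx => contDiffAt_delPairing (hψ x) (sL x hx)
  obtain ⟨B₃, hB₃, bψN⟩ := exists_norm_bound hK
    fun x hx => contDiffAt_delPairing (hψ x) (sN x hx)
  obtain ⟨B₄, hB₄, brN⟩ := exists_norm_bound hK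
    fun x hx => contDiffAt_delPairing (hr x hx) (sN x hx)
  obtain ⟨B₅, hB₅, bS⟩ := exists_norm_bound (F := frameScale r) hK
    fun x hx => contDiffAt_frameScale (hr x hx) (hd x hx)
  set M := 2 * C + 1 with hM
  have hMpos : 0 < M := by positivity
  set C₃ := 16 * C + 8 * (M * (B₂ * B₄)) ^ 2 with hC₃
  have hC₃pos : 0 < C₃ := by positivity
  -- `C₃` is the factor in the LN bound, so K makes the NN entry at least `C₃` and the determinant
  -- nonnegative. The radius `δ` is chosen after K, using r(p₀) = 0.
  obtain ⟨K, hKdef⟩ : ∃ K, K = (2 * B₁ + 4 * M * (B₄ * B₃) + C₃) * B₅ ^ 2 := ⟨_, rfl⟩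
  have hφ : ∀ x, ContDiffAt ℝ ∞ (weight p₀ K M) x := fun x =>
    (contDiff_weight p₀ K M).contDiffAt
  have hr0 := (hr p₀ (Metric.mem_closedBall_self hR.le)).continuousAt
  have ev1 : ∀ᶠ x in 𝓝 p₀, |r x| < 1 :=
    hr0.abs.eventually_lt continuousAt_const (by simp [h0])
  have ev2 : ∀ᶠ x in 𝓝 p₀, |r x * weight p₀ K M x| < 1 / 4 :=
    (hr0.mul (hφ p₀).continuousAt).abs.eventually_lt continuousAt_const (by simp [h0])
  obtain ⟨δ, hδ, hball⟩ := Metric.eventually_nhds_iff_ball.1 (ev1.and ev2)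
  refine ⟨K, M, min δ R, by positivity, min_le_right _ _, fun q hq => ?_⟩
  obtain ⟨hq1, hq2⟩ := hball q (Metric.ball_subset_ball (min_le_left _ _) hq)
  have hqR : q ∈ Metric.ball p₀ R := Metric.ball_subset_ball (min_le_right _ _) hq
  have hqc := Metric.ball_subset_closedBall hqR
  refine ⟨hq2.le, fun ξ => ?_⟩
  have hrq := hr q hqc
  have hdq := hd q hqc
  have hμ0 := hLL q hqR
  have hL := le_leviForm_modify_vecL hrq hdq hq2.le hC hμ0
  have hN := le_leviForm_modify_vecN hrq hdq hq2.le hq1.le hMpos hC₃pos (bNN q hqc)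
    (mul_le_mul (brN q hqc) (bψN q hqc) (norm_nonneg _) hB₄.le)
    ((le_abs_self _).trans (bS q hqc)) hKdef
  have hLN' := norm_complexHessian_modify_sq_le hrq hq2.le hC hMpos hμ0 (hLN q hqR)
    (mul_le_mul (bψL q hqc) (brN q hqc) (norm_nonneg _) hB₂.le)
  have hnn : 0 ≤ (hessLL r q + C * r q ^ 2) / 2 + r q ^ 2 := by positivity
  obtain ⟨a, b, rfl⟩ := exists_frame_coeffs (differentiableAt_of_smooth hrq) hdq ξ
  exact leviForm_combination_nonneg (contDiffAt_modify hrq (hφ q)) (hnn.trans hL)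
    (hC₃pos.le.trans hN) (hLN'.trans (mul_le_mul hL hN hC₃pos.le (hnn.trans hL))) a b

/-! ### Local defining functions and the boundary -/

namespace IsLocalDefiningFunction

variable {Ω U : Set C2} {p : C2} {r : C2 → ℝ}

theorem contDiffAt (h : IsLocalDefiningFunction Ω p U r) {x : C2} (hx : x ∈ U) :
    ContDiffAt ℝ ∞ r x :=
  h.smooth.contDiffAt (h.isOpen.mem_nhds hx)

theorem eq_zero_of_mem_frontier (h : IsLocalDefiningFunction Ω p U r) (hΩ : IsOpen Ω) {x : C2}
    (hx : x ∈ frontier Ω) (hxU : x ∈ U) : r x = 0 := by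
  rw [hΩ.frontier_eq] at hx
  apply le_antisymm
  · by_contra! hpos
    have hev : ∀ᶠ y in 𝓝 x, 0 < r y :=
      continuousAt_const.eventually_lt (h.contDiffAt hxU).continuousAt hpos
    obtain ⟨y, ⟨hy0, hyU⟩, hyΩ⟩ := mem_closure_iff_nhds.1 hx.1 _
      (Filter.inter_mem hev (h.isOpen.mem_nhds hxU))
    have : y ∈ {q | q ∈ U ∧ r q < 0} := h.inter_eq ▸ ⟨hyΩ, hyU⟩
    exact absurd this.2 (not_lt.2 (le_of_lt hy0))
  · by_contra! hneg
    have : x ∈ Ω ∩ U := h.inter_eq ▸ ⟨hxU, hneg⟩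
    exact hx.2 this.1

/-- A zero of r outside the closure of Ω would be a local minimum, hence critical. Needed because
the normal projection only yields points with r = 0. -/
theorem mem_frontier_of_eq_zero (h : IsLocalDefiningFunction Ω p U r) (hΩ : IsOpen Ω) {x : C2}
    (hxU : x ∈ U) (h0 : r x = 0) (hd : fderiv ℝ r x ≠ 0) : x ∈ frontier Ω := by
  rw [hΩ.frontier_eq]
  constructor
  · by_contra hx
    apply hd
    apply IsLocalMin.fderiv_eq_zero
    filter_upwards [isClosed_closure.isOpen_compl.mem_nhds hx, h.isOpen.mem_nhds hxU] with y hy hyU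
    rw [h0]
    by_contra! hneg
    have : y ∈ Ω ∩ U := h.inter_eq ▸ ⟨hyU, hneg⟩
    exact hy (subset_closure this.1)
  · intro hx
    have : x ∈ {q | q ∈ U ∧ r q < 0} := h.inter_eq ▸ ⟨hx, hxU⟩
    exact this.2.ne h0

theorem mono (h : IsLocalDefiningFunction Ω p U r) {V : Set C2} (hV : IsOpen V) (hp : p ∈ V)
    (hVU : V ⊆ U) : IsLocalDefiningFunction Ω p V r where
  isOpen := hV
  mem := hp
  smooth := h.smooth.mono hVU
  inter_eq := by
    ext x
    constructor
    · rintro ⟨hx, hxV⟩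
      have : x ∈ {q | q ∈ U ∧ r q < 0} := h.inter_eq ▸ ⟨hx, hVU hxV⟩
      exact ⟨hxV, this.2⟩
    · rintro ⟨hxV, hx⟩
      have : x ∈ Ω ∩ U := h.inter_eq ▸ ⟨hVU hxV, hx⟩
      exact ⟨this.1, hxV⟩
  fderiv_ne_zero := fun q hq => h.fderiv_ne_zero q ⟨hq.1, hVU hq.2⟩

theorem exists_closedBall (h : IsLocalDefiningFunction Ω p U r) (hp : p ∈ frontier Ω)
    {V : Set C2} (hV : IsOpen V) (hpV : p ∈ V) :
    ∃ R : ℝ, 0 < R ∧ Metric.closedBall p R ⊆ U ∩ V ∧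
      ∀ x ∈ Metric.closedBall p R, fderiv ℝ r x ≠ 0 := by
  have hc : ContinuousAt (fderiv ℝ r) p :=
    ((h.contDiffAt h.mem).fderiv_right (m := ∞) (by simp)).continuousAt
  have hev := hc.eventually_ne (h.fderiv_ne_zero p ⟨hp, h.mem⟩)
  obtain ⟨R, hR, hb⟩ := Metric.nhds_basis_closedBall.eventually_iff.1
    (hev.and (Filter.inter_mem (h.isOpen.mem_nhds h.mem) (hV.mem_nhds hpV)))
  exact ⟨R, hR, fun x hx => (hb hx).2, fun x hx => (hb hx).1⟩

theorem modify_weight (h : IsLocalDefiningFunction Ω p U r) (hΩ : IsOpen Ω) {K M : ℝ}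
    (hs : ∀ q ∈ U, |r q * weight p K M q| ≤ 1 / 4) :
    IsLocalDefiningFunction Ω p U (modify r (weight p K M)) where
  isOpen := h.isOpen
  mem := h.mem
  smooth := fun _ hx =>
    (contDiffAt_modify (h.contDiffAt hx) (contDiff_weight p K M).contDiffAt).contDiffWithinAt
  inter_eq := by
    rw [h.inter_eq]
    ext x
    refine and_congr_right fun hx => ?_
    -- r + φr² = r(1 + rφ) with a positive factor, so signs agree.
    have hpos : 0 < 1 + r x * weight p K M x := by linarith [(abs_le.1 (hs x hx)).1]
    have e : modify r (weight p K M) x = r x * (1 + r x * weight p K M x) := by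
      rw [modify]; ring
    rw [e, mul_neg_iff]
    constructor
    · exact fun h => Or.inr ⟨h, hpos⟩
    · rintro (h | h)
      · linarith [h.2]
      · exact h.1
  fderiv_ne_zero := fun q hq => by
    rw [fderiv_modify (differentiableAt_of_smooth (h.contDiffAt hq.2))
      (differentiableAt_of_smooth (contDiff_weight p K M).contDiffAt)
      (h.eq_zero_of_mem_frontier hΩ hq.1 hq.2)]
    exact h.fderiv_ne_zero q hq

end IsLocalDefiningFunction

/-! ### The two implications -/

theorem exists_bigO_of_psh {Ω U V : Set C2} {p₀ : C2} {r : C2 → ℝ} (hp₀ : p₀ ∈ frontier Ω)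
    (h : IsLocalDefiningFunction Ω p₀ U r) (hV : IsOpen V) (hpV : p₀ ∈ V) (hpsh : PshOn r V) :
    ∃ W, IsLocalDefiningFunction Ω p₀ W r ∧
      BigOOn (fun q => ‖hessLN r q‖ ^ 2) (hessLL r) (frontier Ω ∩ W) ∧
      BigOOn (fun q => |nuDeriv r (hessLL r) q| ^ 2) (hessLL r) (frontier Ω ∩ W) := by
  obtain ⟨R, hR, hsub, hd⟩ := h.exists_closedBall hp₀ hV hpV
  have hr : ∀ x ∈ Metric.closedBall p₀ R, ContDiffAt ℝ ∞ r x := fun x hx =>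
    h.contDiffAt (hsub hx).1
  have hpos : ∀ x ∈ Metric.closedBall p₀ R, 0 ≤ hessLL r x := fun x hx =>
    hpsh x (hsub hx).2 _
  have hball : Metric.closedBall p₀ (R / 2) ⊆ Metric.closedBall p₀ R :=
    Metric.closedBall_subset_closedBall (by linarith)
  have hK : ∀ K ⊆ frontier Ω ∩ Metric.ball p₀ (R / 2), K ⊆ Metric.closedBall p₀ (R / 2) :=
    fun K hK x hx => Metric.ball_subset_closedBall (hK hx).2
  -- Half the radius, since the derivative estimate needs f ≥ 0 on a ball twice as large.
  refine ⟨Metric.ball p₀ (R / 2), h.mono Metric.isOpen_ball (Metric.mem_ball_self (by linarith))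
    fun x hx => (hsub (hball (Metric.ball_subset_closedBall hx))).1, ?_, ?_⟩
  · obtain ⟨B, hB, bNN⟩ := exists_norm_bound (isCompact_closedBall p₀ R)
      fun x hx => contDiffAt_leviForm (hr x hx) (contDiffAt_vecN (hr x hx) (hd x hx))
    intro K _ hKs
    refine ⟨B, hB, fun q hq => ?_⟩
    have hqR := hball (hK K hKs hq)
    rw [abs_of_nonneg (by positivity), abs_of_nonneg (hpos q hqR)]
    refine (norm_complexHessian_sq_le (hr q hqR) (hpsh q (hsub hqR).2) _ _).trans ?_
    rw [mul_comm]
    exact mul_le_mul_of_nonneg_right ((le_abs_self _).trans (bNN q hqR)) (hpos q hqR)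
  · have h2 : 2 * (R / 2) = R := by ring
    obtain ⟨C, hC, hb⟩ := exists_sq_fderiv_le (f := hessLL r) (p := p₀) (half_pos hR)
      (by rw [h2]; exact fun x hx => contDiffAt_hessLL (hr x hx) (hd x hx)) (by rwa [h2])
    intro K _ hKs
    refine ⟨C, hC, fun q hq => ?_⟩
    have hqR := hball (hK K hKs hq)
    rw [abs_of_nonneg (by positivity), abs_of_nonneg (hpos q hqR)]
    refine (sq_abs _).le.trans ?_
    exact hb q (hK K hKs hq) _ (norm_vecN (differentiableAt_of_smooth (hr q hqR)) (hd q hqR))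

theorem exists_psh_of_bigO {Ω U : Set C2} {p₀ : C2} {r : C2 → ℝ} (hΩ : IsOpen Ω)
    (hpc : PseudoconvexAt Ω p₀) (hp₀ : p₀ ∈ frontier Ω) (h : IsLocalDefiningFunction Ω p₀ U r)
    (hLN : BigOOn (fun q => ‖hessLN r q‖ ^ 2) (hessLL r) (frontier Ω ∩ U))
    (hν : BigOOn (fun q => |nuDeriv r (hessLL r) q| ^ 2) (hessLL r) (frontier Ω ∩ U)) :
    ∃ W ρ, IsLocalDefiningFunction Ω p₀ W ρ ∧ PshOn ρ W := by
  obtain ⟨V, hV, hpV, hpos⟩ := hpc U r h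
  obtain ⟨R, hR, hsub, hd⟩ := h.exists_closedBall hp₀ hV hpV
  have hr : ∀ x ∈ Metric.closedBall p₀ R, ContDiffAt ℝ ∞ r x := fun x hx =>
    h.contDiffAt (hsub hx).1
  have h0 := h.eq_zero_of_mem_frontier hΩ hp₀ h.mem
  set K := frontier Ω ∩ Metric.closedBall p₀ R
  have hK : IsCompact K := (isCompact_closedBall p₀ R).inter_left isClosed_frontier
  have hKU : K ⊆ frontier Ω ∩ U := fun x hx => ⟨hx.1, (hsub hx.2).1⟩
  have hmem : ∀ p ∈ Metric.closedBall p₀ R, r p = 0 → p ∈ K := fun p hp hp0 =>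
    ⟨h.mem_frontier_of_eq_zero hΩ (hsub hp).1 hp0 (hd p hp), hp⟩
  have hnn : ∀ p ∈ Metric.closedBall p₀ R, r p = 0 → 0 ≤ hessLL r p := fun p hp hp0 =>
    hpos p ⟨(hmem p hp hp0).1, hsub hp⟩ _ (delPairing_vecL r p)
  obtain ⟨C₁, hC₁, b₁⟩ := hLN K hK hKU
  obtain ⟨C₂, hC₂, b₂⟩ := hν K hK hKU
  obtain ⟨C, hC, δ, hδ, hδR, hb⟩ := exists_hessian_bounds (C₀ := C₁ + C₂) hR h0 hr hd
    (by positivity) hnn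
    (fun p hp hp0 => by
      have := b₁ p (hmem p hp hp0)
      have hn := hnn p hp hp0
      rw [abs_of_nonneg (by positivity), abs_of_nonneg hn] at this
      linarith [mul_nonneg hC₂.le hn])
    (fun p hp hp0 => by
      have := b₂ p (hmem p hp hp0)
      have hn := hnn p hp hp0
      rw [abs_of_nonneg (by positivity), abs_of_nonneg hn] at this
      rw [← sq_abs]
      dsimp only at this
      linarith [mul_nonneg hC₁.le hn])
  have hbR : Metric.closedBall p₀ δ ⊆ Metric.closedBall p₀ R :=
    Metric.closedBall_subset_closedBall hδR
  obtain ⟨K, M, ε, hε, hεδ, hfin⟩ := exists_leviForm_modify_nonneg hδ h0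
    (fun x hx => hr x (hbR hx)) (fun x hx => hd x (hbR hx)) hC
    (fun q hq => (hb q hq).1) (fun q hq => (hb q hq).2)
  have hloc : IsLocalDefiningFunction Ω p₀ (Metric.ball p₀ ε) r :=
    h.mono Metric.isOpen_ball (Metric.mem_ball_self hε) fun x hx =>
      (hsub (Metric.mem_closedBall.2 ((Metric.mem_ball.1 hx).le.trans (hεδ.trans hδR)))).1
  exact ⟨Metric.ball p₀ ε, modify r (weight p₀ K M),
    hloc.modify_weight hΩ fun q hq => (hfin q hq).1, fun q hq => (hfin q hq).2⟩

end PshBoundary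

end

theorem propositionL (Ω : Set PshBoundary.C2)
    (hΩ : PshBoundary.IsSmoothlyBoundedDomain Ω) (hpc : PshBoundary.Pseudoconvex Ω)
    (p₀ : PshBoundary.C2) (hp₀ : p₀ ∈ frontier Ω) :
    (∃ (U : Set PshBoundary.C2) (r : PshBoundary.C2 → ℝ),
        PshBoundary.IsLocalDefiningFunction Ω p₀ U r ∧
        ∃ V : Set PshBoundary.C2, IsOpen V ∧ p₀ ∈ V ∧ V ⊆ U ∧ PshBoundary.PshOn r V) ↔
    (∃ (U : Set PshBoundary.C2) (r : PshBoundary.C2 → ℝ),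
        PshBoundary.IsLocalDefiningFunction Ω p₀ U r ∧
        PshBoundary.BigOOn (fun q => ‖PshBoundary.hessLN r q‖ ^ 2)
          (PshBoundary.hessLL r) (frontier Ω ∩ U) ∧
        PshBoundary.BigOOn (fun q => |PshBoundary.nuDeriv r (PshBoundary.hessLL r) q| ^ 2)
          (PshBoundary.hessLL r) (frontier Ω ∩ U)) := by
  constructor
  · rintro ⟨U, r, h, V, hV, hpV, -, hpsh⟩
    obtain ⟨W, hW⟩ := PshBoundary.exists_bigO_of_psh hp₀ h hV hpV hpsh
    exact ⟨W, r, hW⟩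
  · rintro ⟨U, r, h, hLN, hν⟩
    obtain ⟨W, ρ, hW, hpsh⟩ :=
      PshBoundary.exists_psh_of_bigO hΩ.isOpen (hpc p₀ hp₀) hp₀ h hLN hν
    exact ⟨W, ρ, hW, W, hW.isOpen, hW.mem, subset_rfl, hpsh⟩
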